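/- For $\nu>0$ let $A^{(\nu)}(\mathbb D)$ be the Hilbert space of holomorphic functions on the open unit disc $\mathbb D$ with reproducing kernel $(1-z\bar w)^{-2\nu}$; the functions $\sqrt{(2\nu)_n/n!}\,z^n$, $n\ge 0$, form an orthonormal basis of it, where $(x)_n=x(x+1)\cdots(x+n-1)$. Let $m\ge 1$ be an integer, let $\lambda$ be real with $2\lambda-m>0$, let $\mu_0=1$ and $\mu_1,\dots,\mu_m>0$, and put $2\lambda_j=2\lambda-m+2j$ for $0\le j\le m$. For $f\in A^{(\lambda_j)}(\mathbb D)$ let $\Gamma_jf:\mathbb D\to\mathbb C^{m+1}$ be the function with components $$(\Gamma_jf)_\ell=\binom{\ell}{j}\frac{1}{(2\lambda_j)_{\ell-j}}f^{(\ell-j)}\ \text{ if } j\le\ell\le m,\qquad (\Gamma_jf)_\ell=0\ \text{ if } \ell<j .$$ Let $\mathbf A^{(\lambda,\mu)}(\mathbb D)$ be the Hilbert space of all functions $\sum_{j=0}^m\Gamma_jf_j$ with $f_j\in A^{(\lambda_j)}(\mathbb D)$ (the $f_j$ are determined by the sum), with the inner product $\big\langle\sum_j\Gamma_jf_j,\sum_j\Gamma_jg_j\big\rangle=\sum_j\mu_j^{-2}\langle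 f_j,g_j\rangle$. Put $e_n^j=\Gamma_j\big(\sqrt{(2\lambda_j)_n/n!}\,z^n\big)$, so that the vectors $\mu_je_n^j$ form an orthonormal basis of $\mathbf A^{(\lambda,\mu)}(\mathbb D)$, and let $H(n)$ be the linear span of the vectors $e^j_{n-j}$, $0\le j\le\min(m,n)$. **Theorem.** The operator $M$, $(MF)(z)=zF(z)$, is defined and bounded on the whole of $\mathbf A^{(\lambda,\mu)}(\mathbb D)$. It is a block shift: $\mathbf A^{(\lambda,\mu)}(\mathbb D)$ is the orthogonal direct sum of the spaces $H(n)$, $n\ge 0$, and $M H(n)\subseteq H(n+1)$. Its blocks, that is, the matrices $M(n)$ with $$M\mu_je^j_{n-j}=\sum_{0\le k\le\min(m,n+1)}M(n)_{k,j}\,\mu_ke^k_{n+1-k}\qquad(0\le j\le \min(m,n)),$$ which are of size $(m+1)\times(m+1)$ for $n\ge m$, satisfy $M(n)=I+O(1/n)$ entrywise as $n\to\infty$. There is a bounded operator $U_+$ on $\mathbf A^{(\lambda,\mu)}(\mathbb D)$ with $U_+e^j_n=e^j_{n+1}$ for all $0\le j\le m$, $n\ge0$, and $M-U_+$ is a Hilbert–Schmidt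 operator. The adjoint $T=M^*$ belongs to the Cowen–Douglas class $B_{m+1}(\mathbb D)$: for every $w\in\mathbb D$, $w$ is in the spectrum of $T$, $T-w$ is surjective and $\dim\ker(T-w)=m+1$; and the subspaces $\ker(T-w)$, $w\in\mathbb D$, span a dense subspace. -/

import Mathlib

open scoped ComplexConjugate Topology
open Complex.UnitDisc Filter

noncomputable section

namespace HomogShift

/-- The Pochhammer symbol `(x)_n = x (x + 1) ⋯ (x + n - 1)`. -/
def poch (x : ℝ) (n : ℕ) : ℝ := (ascPochhammer ℝ n).eval x

lemma poch_pos {x : ℝ} (hx : 0 < x) (n : ℕ) : 0 < poch x n := ascPochhammer_pos n x hx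

/-- The coefficient `√((2ν)_n / n!)`. -/
def coef (ν : ℝ) (n : ℕ) : ℝ := Real.sqrt (poch (2 * ν) n / n.factorial)

lemma coef_pos {ν : ℝ} (hν : 0 < ν) (n : ℕ) : 0 < coef ν n :=
  Real.sqrt_pos.2 (div_pos (poch_pos (by positivity) n) (by positivity))

lemma coef_sq {ν : ℝ} (hν : 0 < ν) (n : ℕ) : coef ν n ^ 2 = Ring.choose (2 * ν + n - 1) n := by
  have h := Ring.factorial_nsmul_multichoose_eq_ascPochhammer (2 * ν) n
  rw [Polynomial.ascPochhammer_smeval_eq_eval, nsmul_eq_mul, Ring.multichoose_eq] at h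
  rw [coef, Real.sq_sqrt (div_pos (poch_pos (by positivity) n) (by positivity)).le, poch, ← h]
  field_simp

lemma hasSum_coef_sq {ν : ℝ} (hν : 0 < ν) {z : ℂ} (hz : ‖z‖ < 1) :
    HasSum (fun n : ℕ => ((coef ν n : ℂ)) ^ 2 * z ^ n) ((1 - z) ^ (-(2 * ν : ℂ))) := by
  have h := (Complex.one_div_one_sub_cpow_hasFPowerSeriesOnBall_zero (2 * ν : ℂ)).hasSum
    (y := z) (by simpa [enorm_eq_nnnorm, ← NNReal.coe_lt_one] using hz)
  rw [Complex.cpow_neg]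
  simp only [zero_add, one_div, FormalMultilinearSeries.ofScalars_apply_eq, smul_eq_mul] at h
  convert! h using 2 with n
  congr 1
  have := coef_sq hν n
  rw [← Complex.ofReal_pow, this, Complex.ofReal_choose]
  push_cast; rfl

lemma summable_coef_sq {ν : ℝ} (hν : 0 < ν) {r : ℝ} (h0 : 0 ≤ r) (hr : r < 1) :
    Summable (fun n : ℕ => (coef ν n) ^ 2 * r ^ n) := by
  have h := (hasSum_coef_sq hν (z := (r : ℂ)) (by simpa [abs_of_nonneg h0] using hr)).summable
  exact_mod_cast h

/-- The space `A^(ν)(𝔻)`, `ν > 0`: the Hilbert space of the functions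
`z ↦ ∑ a_n √((2ν)_n / n!) z^n` with square summable coefficients `a`, in which the functions
`√((2ν)_n / n!) z^n` form an orthonormal basis.  It is the Hilbert space of holomorphic functions
on the disc with reproducing kernel `(1 - z w̄)^(-2ν)`, see `kernel_discSpace`. -/
def DiscSpace (_ν : {x : ℝ // 0 < x}) : Type := lp (fun _ : ℕ => ℂ) 2

variable {ν : {x : ℝ // 0 < x}}

instance : NormedAddCommGroup (DiscSpace ν) :=
  inferInstanceAs (NormedAddCommGroup (lp (fun _ : ℕ => ℂ) 2))
instance : InnerProductSpace ℂ (DiscSpace ν) :=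
  inferInstanceAs (InnerProductSpace ℂ (lp (fun _ : ℕ => ℂ) 2))
instance : CompleteSpace (DiscSpace ν) :=
  inferInstanceAs (CompleteSpace (lp (fun _ : ℕ => ℂ) 2))

/-- The coefficients of an element with respect to the orthonormal basis `√((2ν)_n / n!) z^n`. -/
def DiscSpace.coeff (f : DiscSpace ν) (n : ℕ) : ℂ := (show lp (fun _ : ℕ => ℂ) 2 from f) n

/-- The kernel vector at `z`, used to see that the evaluation at `z` is continuous. -/
def kerVec (ν : {x : ℝ // 0 < x}) (z : 𝔻) : DiscSpace ν :=
  (⟨fun n => (coef ν n : ℂ) * conj (z : ℂ) ^ n, by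
    refine memℓp_gen ?_
    have h := summable_coef_sq ν.2 (sq_nonneg ‖(z : ℂ)‖) z.sq_norm_lt_one
    refine h.congr fun n => ?_
    rw [ENNReal.toReal_ofNat, Real.rpow_two, norm_mul, norm_pow, RCLike.norm_conj,
      Complex.norm_real, Real.norm_eq_abs, mul_pow, sq_abs, ← pow_mul, ← pow_mul,
      mul_comm n 2]⟩ : lp (fun _ : ℕ => ℂ) 2)

lemma hasSum_inner_kerVec (f : DiscSpace ν) (z : 𝔻) :
    HasSum (fun n => f.coeff n * (coef ν n * (z : ℂ) ^ n)) (inner ℂ (kerVec ν z) f) := by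
  have h := lp.hasSum_inner (𝕜 := ℂ) (G := fun _ : ℕ => ℂ)
    (show lp (fun _ : ℕ => ℂ) 2 from kerVec ν z) (show lp (fun _ : ℕ => ℂ) 2 from f)
  convert! h using 2 with n
  simp [DiscSpace.coeff, kerVec, RCLike.inner_apply]

lemma coeff_add (f g : DiscSpace ν) (n : ℕ) : (f + g).coeff n = f.coeff n + g.coeff n := rfl
lemma coeff_smul (c : ℂ) (f : DiscSpace ν) (n : ℕ) : (c • f).coeff n = c * f.coeff n := rfl

lemma coeff_ext {f g : DiscSpace ν} (h : ∀ n, f.coeff n = g.coeff n) : f = g :=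
  lp.ext (funext h)

/-- The extension of a function on the disc to the plane by zero. -/
def ext0 (f : 𝔻 → ℂ) (z : ℂ) : ℂ := if h : ‖z‖ < 1 then f (.mk z h) else 0

lemma ext0_coe (f : 𝔻 → ℂ) (z : 𝔻) : ext0 f z = f z := by
  simp only [ext0, z.norm_lt_one, dite_true]
  rfl

lemma hasFPowerSeries_aux (f : DiscSpace ν) :
    HasFPowerSeriesOnBall (ext0 fun z => ∑' n, f.coeff n * (coef ν n * (z : ℂ) ^ n))
      (.ofScalars ℂ fun n => f.coeff n * coef ν n) 0 1 where
  r_le := by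
    refine ENNReal.le_of_forall_nnreal_lt fun r hr => ?_
    have hr' : ‖((r : ℝ) : ℂ)‖ < 1 := by simpa using hr
    have h := (hasSum_inner_kerVec f (.mk _ hr')).summable.norm
    refine FormalMultilinearSeries.le_radius_of_summable_norm _ (h.congr fun n => ?_)
    simp [mul_assoc]
  r_pos := one_pos
  hasSum := by
    intro y hy
    have hy' : ‖y‖ < 1 := by simpa [enorm_eq_nnnorm, ← NNReal.coe_lt_one] using hy
    have h := (hasSum_inner_kerVec f (.mk y hy')).summable.hasSum
    simp only [zero_add, ext0, hy', dite_true]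
    convert! h using 2 with n
    simp only [FormalMultilinearSeries.ofScalars_apply_eq, smul_eq_mul, Complex.UnitDisc.coe_mk]
    ring

instance : RKHS ℂ (DiscSpace ν) 𝔻 ℂ where
  coeCLM :=
    { toFun := fun f z => ∑' n, f.coeff n * (coef ν n * (z : ℂ) ^ n)
      map_add' := fun f g => by
        funext z
        simp only [(hasSum_inner_kerVec _ z).tsum_eq, inner_add_right, Pi.add_apply]
      map_smul' := fun c f => by
        funext z
        simp only [(hasSum_inner_kerVec _ z).tsum_eq, inner_smul_right, Pi.smul_apply,
          RingHom.id_apply, smul_eq_mul]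
      cont := by
        refine continuous_pi fun z => ?_
        simp only [(hasSum_inner_kerVec _ z).tsum_eq]
        fun_prop }
  coeCLM_injective := by
    intro f g h
    have h' : (fun z : 𝔻 => ∑' n, f.coeff n * (coef ν n * (z : ℂ) ^ n)) =
      fun z : 𝔻 => ∑' n, g.coeff n * (coef ν n * (z : ℂ) ^ n) := h
    have hf := (hasFPowerSeries_aux f).hasFPowerSeriesAt
    rw [h'] at hf
    have := hf.eq_formalMultilinearSeries (hasFPowerSeries_aux g).hasFPowerSeriesAt
    rw [FormalMultilinearSeries.ofScalars_series_eq_iff] at this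
    refine coeff_ext fun n => ?_
    have hn := congrFun this n
    exact mul_right_cancel₀ (by exact_mod_cast (coef_pos ν.2 n).ne') hn

lemma discSpace_apply (f : DiscSpace ν) (z : 𝔻) :
    f z = ∑' n, f.coeff n * (coef ν n * (z : ℂ) ^ n) := rfl

lemma discSpace_apply_eq_inner (f : DiscSpace ν) (z : 𝔻) : f z = inner ℂ (kerVec ν z) f :=
  (hasSum_inner_kerVec f z).tsum_eq

lemma hasFPowerSeries_discSpace (f : DiscSpace ν) :
    HasFPowerSeriesOnBall (ext0 f) (.ofScalars ℂ fun n => f.coeff n * coef ν n) 0 1 :=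
  hasFPowerSeries_aux f

/-- The reproducing kernel of `A^(ν)(𝔻)` is `(1 - z w̄)^(-2ν)`. -/
theorem kernel_discSpace (z w : 𝔻) (v : ℂ) :
    RKHS.kernel (DiscSpace ν) z w v = (1 - (z : ℂ) * conj (w : ℂ)) ^ (-(2 * (ν : ℝ) : ℂ)) * v := by
  have hk : RKHS.kerFun (DiscSpace ν) w v = v • kerVec ν w := by
    refine ext_inner_right ℂ fun f => ?_
    rw [RKHS.kerFun_inner, discSpace_apply_eq_inner, inner_smul_left, RCLike.inner_apply, mul_comm]
  rw [← RKHS.kerFun_apply, hk, RKHS.coe_smul, Pi.smul_apply, discSpace_apply, smul_eq_mul,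
    mul_comm]
  congr 1
  have hz : ‖(z : ℂ) * conj (w : ℂ)‖ < 1 := by
    rw [norm_mul, RCLike.norm_conj]
    exact mul_lt_one_of_nonneg_of_lt_one_left (norm_nonneg _) z.norm_lt_one w.norm_lt_one.le
  rw [← (hasSum_coef_sq ν.2 hz).tsum_eq]
  refine tsum_congr fun n => ?_
  simp only [DiscSpace.coeff, kerVec]
  ring

/-- Every element of `A^(ν)(𝔻)` is holomorphic on the disc. -/
lemma analyticAt_discSpace (f : DiscSpace ν) (z : 𝔻) : AnalyticAt ℂ (ext0 f) z :=
  (hasFPowerSeries_discSpace f).analyticAt_of_mem (by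
    simpa [enorm_eq_nnnorm, ← NNReal.coe_lt_one] using z.norm_lt_one)

/-- The monomial `z^n` as an element of `A^(ν)(𝔻)`. -/
def monomial (ν : {x : ℝ // 0 < x}) (n : ℕ) : DiscSpace ν :=
  (lp.single 2 n (((coef ν n)⁻¹ : ℝ) : ℂ) : lp (fun _ : ℕ => ℂ) 2)

lemma monomial_apply (n : ℕ) (z : 𝔻) : monomial ν n z = (z : ℂ) ^ n := by
  rw [discSpace_apply, tsum_eq_single n]
  · have : (coef ν n : ℂ) ≠ 0 := by exact_mod_cast (coef_pos ν.2 n).ne'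
    simp [DiscSpace.coeff, monomial, this]
  · intro k hk
    have h0 : (monomial ν n).coeff k = 0 := lp.single_apply_ne 2 n _ hk
    rw [h0, zero_mul]

/-- The `k`-th derivative `f^(k)(z)` of `f ∈ A^(ν)(𝔻)`. -/
def derivDisc (k : ℕ) (f : DiscSpace ν) (z : 𝔻) : ℂ := iteratedDeriv k (ext0 f) z

lemma ext0_add (f g : 𝔻 → ℂ) : ext0 (f + g) = ext0 f + ext0 g := by
  funext z; by_cases h : ‖z‖ < 1 <;> simp [ext0, h]

lemma ext0_smul (c : ℂ) (f : 𝔻 → ℂ) : ext0 (c • f) = c • ext0 f := by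
  funext z; by_cases h : ‖z‖ < 1 <;> simp [ext0, h]

lemma derivDisc_zero (f : DiscSpace ν) (z : 𝔻) : derivDisc 0 f z = f z := by
  simp [derivDisc, ext0_coe]

lemma derivDisc_add (k : ℕ) (f g : DiscSpace ν) (z : 𝔻) :
    derivDisc k (f + g) z = derivDisc k f z + derivDisc k g z := by
  rw [derivDisc, RKHS.coe_add, ext0_add]
  exact iteratedDeriv_add (analyticAt_discSpace f z).contDiffAt
    (analyticAt_discSpace g z).contDiffAt

lemma derivDisc_smul (k : ℕ) (c : ℂ) (f : DiscSpace ν) (z : 𝔻) :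
    derivDisc k (c • f) z = c * derivDisc k f z := by
  rw [derivDisc, RKHS.coe_smul, ext0_smul, iteratedDeriv_const_smul_field]
  rfl

lemma continuous_derivDisc (k : ℕ) (z : 𝔻) :
    Continuous fun f : DiscSpace ν => derivDisc k f z := by
  induction k generalizing z with
  | zero => simpa only [derivDisc_zero] using RKHS.continuous_eval z
  | succ k ih =>
    -- a sequence of points of the disc converging to `z`
    have hlim : ∀ f : DiscSpace ν, Tendsto
        (fun h : ℂ => h⁻¹ • (iteratedDeriv k (ext0 f) (z + h) - iteratedDeriv k (ext0 f) z))
        (𝓝[≠] 0) (𝓝 (derivDisc (k + 1) f z)) := by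
      intro f
      have hd : HasDerivAt (iteratedDeriv k (ext0 f)) (derivDisc (k + 1) f z) z := by
        rw [derivDisc, iteratedDeriv_succ]
        have ha : AnalyticAt ℂ (iteratedDeriv k (ext0 f)) z := by
          rw [iteratedDeriv_eq_iterate]
          exact (analyticAt_discSpace f z).iterated_deriv k
        exact ha.differentiableAt.hasDerivAt
      exact hasDerivAt_iff_tendsto_slope_zero.1 hd
    obtain ⟨u, hu⟩ := exists_seq_tendsto (𝓝[≠] (0 : ℂ))
    have hin : ∀ᶠ n in atTop, ‖(z : ℂ) + u n‖ < 1 := by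
      have h1 : Tendsto (fun n => ‖(z : ℂ) + u n‖) atTop (𝓝 ‖(z : ℂ) + 0‖) :=
        (tendsto_const_nhds.add (hu.mono_right nhdsWithin_le_nhds)).norm
      exact h1.eventually_lt_const (by simpa using z.norm_lt_one)
    obtain ⟨N, hN⟩ := eventually_atTop.1 hin
    let w : ℕ → 𝔻 := fun n => .mk ((z : ℂ) + u (n + N)) (hN _ (Nat.le_add_left _ _))
    let D : 𝔻 → (DiscSpace ν →L[ℂ] ℂ) := fun x =>
      { toFun := fun f => derivDisc k f x
        map_add' := fun f g => derivDisc_add k f g x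
        map_smul' := fun c f => derivDisc_smul k c f x
        cont := ih x }
    let g : ℕ → (DiscSpace ν →L[ℂ] ℂ) := fun n => (u (n + N))⁻¹ • (D (w n) - D z)
    have hg : Tendsto (fun n f => g n f) atTop (𝓝 fun f => derivDisc (k + 1) f z) := by
      rw [tendsto_pi_nhds]
      intro f
      exact ((hlim f).comp hu).comp (tendsto_add_atTop_nat N)
    exact (continuousLinearMapOfTendsto g hg).continuous

/-- The parameters: `2λ - m > 0`, and positive numbers `μ_0 = 1, μ_1, …, μ_m`. -/
structure Params (m : ℕ) where
  lam : ℝ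
  mu : Fin (m + 1) → ℝ
  lam_gt : 0 < 2 * lam - m
  mu_pos : ∀ j, 0 < mu j
  mu_zero : mu 0 = 1

variable {m : ℕ}

/-- `λ_j`, defined by `2λ_j = 2λ - m + 2j`. -/
def Params.lamj (p : Params m) (j : Fin (m + 1)) : {x : ℝ // 0 < x} :=
  ⟨(2 * p.lam - m + 2 * (j : ℕ)) / 2, by
    have h1 := p.lam_gt
    have h2 : (0 : ℝ) ≤ ((j : ℕ) : ℝ) := Nat.cast_nonneg _
    linarith⟩

/-- The operator `Γ_j` from `A^(λ_j)(𝔻)` to the functions on the disc with values in `ℂ^(m+1)`: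
`(Γ_j f)_ℓ = binom(ℓ, j) / (2λ_j)_(ℓ-j) · f^(ℓ-j)` if `ℓ ≥ j`, and `0` if `ℓ < j`. -/
def Gam (p : Params m) (j : Fin (m + 1)) (f : DiscSpace (p.lamj j)) (z : 𝔻) :
    EuclideanSpace ℂ (Fin (m + 1)) :=
  WithLp.toLp 2 fun l => if j ≤ l then
    (((l : ℕ).choose j / poch (2 * p.lamj j) (l - j) : ℝ) : ℂ) * derivDisc (l - j) f z else 0

lemma Gam_add (p : Params m) (j : Fin (m + 1)) (f g : DiscSpace (p.lamj j)) (z : 𝔻) :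
    Gam p j (f + g) z = Gam p j f z + Gam p j g z := by
  ext l
  by_cases h : j ≤ l <;> simp [Gam, h, derivDisc_add, mul_add]

lemma Gam_smul (p : Params m) (j : Fin (m + 1)) (c : ℂ) (f : DiscSpace (p.lamj j)) (z : 𝔻) :
    Gam p j (c • f) z = c • Gam p j f z := by
  ext l
  by_cases h : j ≤ l
  · simp [Gam, h, derivDisc_smul]; ring
  · simp [Gam, h]

lemma Gam_zero (p : Params m) (j : Fin (m + 1)) (z : 𝔻) : Gam p j 0 z = 0 := by
  simpa using Gam_smul p j 0 0 z

lemma continuous_Gam (p : Params m) (j : Fin (m + 1)) (z : 𝔻) :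
    Continuous fun f => Gam p j f z := by
  refine (PiLp.continuous_toLp 2 _).comp (continuous_pi fun l => ?_)
  by_cases h : j ≤ l
  · simp only [h, if_true]
    exact continuous_const.mul (continuous_derivDisc _ z)
  · simpa only [h, if_false] using continuous_const

/-- The Hilbert space `A^(λ,μ)(𝔻)`: the orthogonal direct sum of the spaces `A^(λ_j)(𝔻)`,
`0 ≤ j ≤ m`, transferred to a space of `ℂ^(m+1)`-valued functions on the disc by the injective map
`Γ = ∑_j μ_j Γ_j`.  So `(f_j)_j` is the function `∑_j μ_j Γ_j f_j`, and the inner product of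
`∑_j Γ_j f_j` and `∑_j Γ_j g_j` is `∑_j μ_j^(-2) ⟪f_j, g_j⟫`, see `inner_sum_embed`. -/
def VecSpace (p : Params m) : Type := PiLp 2 fun j => DiscSpace (p.lamj j)

variable {p : Params m}

instance : NormedAddCommGroup (VecSpace p) :=
  inferInstanceAs (NormedAddCommGroup (PiLp 2 fun j => DiscSpace (p.lamj j)))
instance : InnerProductSpace ℂ (VecSpace p) :=
  inferInstanceAs (InnerProductSpace ℂ (PiLp 2 fun j => DiscSpace (p.lamj j)))
instance : CompleteSpace (VecSpace p) :=
  inferInstanceAs (CompleteSpace (PiLp 2 fun j => DiscSpace (p.lamj j)))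

/-- The component in `A^(λ_j)(𝔻)`. -/
def VecSpace.comp (F : VecSpace p) (j : Fin (m + 1)) : DiscSpace (p.lamj j) :=
  (show PiLp 2 fun j => DiscSpace (p.lamj j) from F) j

lemma comp_add (F G : VecSpace p) (j : Fin (m + 1)) : (F + G).comp j = F.comp j + G.comp j := rfl
lemma comp_smul (c : ℂ) (F : VecSpace p) (j : Fin (m + 1)) : (c • F).comp j = c • F.comp j := rfl
lemma continuous_comp (j : Fin (m + 1)) : Continuous fun F : VecSpace p => F.comp j :=
  PiLp.continuous_apply 2 _ j

instance : RKHS ℂ (VecSpace p) 𝔻 (EuclideanSpace ℂ (Fin (m + 1))) where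
  coeCLM :=
    { toFun := fun F z => ∑ j, (p.mu j : ℂ) • Gam p j (F.comp j) z
      map_add' := fun F G => by
        funext z
        simp only [comp_add, Gam_add, smul_add, Finset.sum_add_distrib, Pi.add_apply]
      map_smul' := fun c F => by
        funext z
        simp only [comp_smul, Gam_smul, Finset.smul_sum, Pi.smul_apply, RingHom.id_apply,
          smul_comm c]
      cont := continuous_pi fun z => continuous_finsetSum _ fun j _ =>
        ((continuous_const_smul (p.mu j : ℂ)).comp (continuous_Gam p j z)).comp
          (continuous_comp j) }
  coeCLM_injective := by
    refine (injective_iff_map_eq_zero _).2 fun F hF => ?_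
    have hF' : ∀ z : 𝔻, ∑ j, (p.mu j : ℂ) • Gam p j (F.comp j) z = 0 := fun z => congrFun hF z
    have key : ∀ (k : ℕ) (j : Fin (m + 1)), (j : ℕ) = k → F.comp j = 0 := by
      intro k
      induction k using Nat.strong_induction_on with
      | _ k ih =>
        intro j hj
        refine RKHS.ext fun z => ?_
        have h := congrArg (fun v : EuclideanSpace ℂ (Fin (m + 1)) => v j) (hF' z)
        simp only [WithLp.ofLp_sum, Finset.sum_apply] at h
        rw [Finset.sum_eq_single j] at h
        · have h1 : (p.mu j : ℂ) ≠ 0 := by exact_mod_cast (p.mu_pos j).ne'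
          simpa [Gam, poch, h1, derivDisc_zero] using h
        · intro i _ hij
          rcases lt_or_gt_of_ne hij with hlt | hgt
          · rw [ih i (by rw [← hj]; exact hlt) i rfl, Gam_zero]; simp
          · have : ¬ i ≤ j := not_le.2 hgt
            simp [Gam, this]
        · simp
    exact PiLp.ext fun j => key j j rfl

lemma vecSpace_apply (F : VecSpace p) (z : 𝔻) :
    F z = ∑ j, (p.mu j : ℂ) • Gam p j (F.comp j) z := rfl

/-- The function `Γ_j f` as an element of `A^(λ,μ)(𝔻)`. -/
def embed (p : Params m) (j : Fin (m + 1)) (f : DiscSpace (p.lamj j)) : VecSpace p :=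
  (PiLp.single 2 j (((p.mu j : ℂ)⁻¹) • f) : PiLp 2 fun j => DiscSpace (p.lamj j))

lemma embed_comp_self (j : Fin (m + 1)) (f : DiscSpace (p.lamj j)) :
    (embed p j f).comp j = (p.mu j : ℂ)⁻¹ • f := PiLp.single_eq_same _ _ _

lemma embed_comp_ne {i j : Fin (m + 1)} (h : i ≠ j) (f : DiscSpace (p.lamj j)) :
    (embed p j f).comp i = 0 := PiLp.single_eq_of_ne _ h _

lemma embed_apply (j : Fin (m + 1)) (f : DiscSpace (p.lamj j)) (z : 𝔻) :
    embed p j f z = Gam p j f z := by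
  rw [vecSpace_apply, Finset.sum_eq_single j]
  · have h1 : (p.mu j : ℂ) ≠ 0 := by exact_mod_cast (p.mu_pos j).ne'
    rw [embed_comp_self, Gam_smul, smul_smul, mul_inv_cancel₀ h1, one_smul]
  · intro i _ hij
    rw [embed_comp_ne hij, Gam_zero, smul_zero]
  · simp

/-- Every element of `A^(λ,μ)(𝔻)` is a sum `∑_j Γ_j f_j`. -/
lemma eq_sum_embed (F : VecSpace p) : F = ∑ j, embed p j ((p.mu j : ℂ) • F.comp j) := by
  have hs : ∀ (s : Finset (Fin (m + 1))) (G : Fin (m + 1) → VecSpace p) (z : 𝔻),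
      (∑ j ∈ s, G j) z = ∑ j ∈ s, G j z := fun s G z => by
    classical
    induction s using Finset.induction_on with
    | empty => simp
    | insert a s ha ih => simp [Finset.sum_insert ha, ih]
  refine RKHS.ext fun z => ?_
  rw [hs, vecSpace_apply]
  exact Finset.sum_congr rfl fun j _ => by rw [embed_apply, Gam_smul]

/-- The inner product of `A^(λ,μ)(𝔻)`. -/
lemma inner_sum_embed (f g : ∀ j, DiscSpace (p.lamj j)) :
    inner ℂ (∑ j, embed p j (f j)) (∑ j, embed p j (g j)) =
      ∑ j, ((p.mu j : ℂ) ^ 2)⁻¹ * inner ℂ (f j) (g j) := by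
  have hc : ∀ (f : ∀ j, DiscSpace (p.lamj j)) (i : Fin (m + 1)),
      (∑ j, embed p j (f j)).comp i = (p.mu i : ℂ)⁻¹ • f i := by
    intro f i
    let φ : VecSpace p →+ DiscSpace (p.lamj i) :=
      AddMonoidHom.mk' (fun F => F.comp i) fun F G => comp_add F G i
    change φ (∑ j, embed p j (f j)) = _
    rw [map_sum, Finset.sum_eq_single i]
    · exact embed_comp_self i (f i)
    · exact fun j _ hj => embed_comp_ne hj.symm (f j)
    · simp
  have h : ∀ F G : VecSpace p, inner ℂ F G = ∑ j, inner ℂ (F.comp j) (G.comp j) :=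
    fun F G => PiLp.inner_apply (𝕜 := ℂ) _ _
  rw [h]
  refine Finset.sum_congr rfl fun j _ => ?_
  rw [hc, hc, inner_smul_left, inner_smul_right, map_inv₀, Complex.conj_ofReal, ← mul_assoc,
    ← mul_inv, sq]

/-- The vector `e_n^j = Γ_j (√((2λ_j)_n / n!) z^n)` of `A^(λ,μ)(𝔻)`. -/
def e (p : Params m) (j : Fin (m + 1)) (n : ℕ) : VecSpace p :=
  embed p j ((coef (p.lamj j) n : ℂ) • monomial (p.lamj j) n)

/-- The vectors `μ_j e_n^j` are orthonormal in `A^(λ,μ)(𝔻)`. -/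
lemma orthonormal_mu_e (p : Params m) :
    Orthonormal ℂ fun a : Fin (m + 1) × ℕ => (p.mu a.1 : ℂ) • e p a.1 a.2 := by
  have hcomp : ∀ (j : Fin (m + 1)) (n : ℕ), ((p.mu j : ℂ) • e p j n).comp j =
      (lp.single 2 n (1 : ℂ) : lp (fun _ : ℕ => ℂ) 2) := by
    intro j n
    have h1 : (p.mu j : ℂ) ≠ 0 := by exact_mod_cast (p.mu_pos j).ne'
    have h2 : (coef (p.lamj j) n : ℂ) ≠ 0 := by exact_mod_cast (coef_pos (p.lamj j).2 n).ne'
    rw [comp_smul, e, embed_comp_self, smul_smul, mul_inv_cancel₀ h1, one_smul]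
    refine (lp.single_smul 2 n _ _).symm.trans ?_
    rw [smul_eq_mul, Complex.ofReal_inv, mul_inv_cancel₀ h2]
  have hne : ∀ (i j : Fin (m + 1)) (n : ℕ), i ≠ j → ((p.mu j : ℂ) • e p j n).comp i = 0 := by
    intro i j n h
    rw [comp_smul, e, embed_comp_ne h, smul_zero]
  have hin : ∀ F G : VecSpace p, inner ℂ F G = ∑ j, inner ℂ (F.comp j) (G.comp j) :=
    fun F G => PiLp.inner_apply (𝕜 := ℂ) _ _
  rw [orthonormal_iff_ite]
  rintro ⟨i, k⟩ ⟨j, n⟩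
  rw [hin, Finset.sum_eq_single j]
  · by_cases hij : i = j
    · subst hij
      rw [hcomp, hcomp]
      refine (lp.inner_single_left (𝕜 := ℂ) (G := fun _ : ℕ => ℂ) k 1 _).trans ?_
      by_cases hkn : k = n
      · subst hkn; simp
      · simp [hkn]
    · rw [hne j i k (Ne.symm hij), inner_zero_left]
      simp [hij]
  · intro l _ hl
    rw [hne l j n hl, inner_zero_right]
  · simp

/-- The space `H(n)`: the linear span of the vectors `e_{n-j}^j`, `0 ≤ j ≤ min(m, n)`. -/
def blockSpace (p : Params m) (n : ℕ) : Submodule ℂ (VecSpace p) :=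
  Submodule.span ℂ {v | ∃ j : Fin (m + 1), (j : ℕ) ≤ n ∧ v = e p j (n - j)}

section Operators

variable {H : Type*} [NormedAddCommGroup H] [InnerProductSpace ℂ H] [CompleteSpace H]

/-- `T` is a block shift with respect to the subspaces `V_n`, `n ≥ 0`: the Hilbert space is the
orthogonal direct sum of the `V_n`, and `T V_n ⊆ V_{n+1}`. -/
def IsBlockShift (T : H →L[ℂ] H) (V : ℕ → Submodule ℂ H) : Prop :=
  IsHilbertSum ℂ (fun n => V n) (fun n => (V n).subtypeₗᵢ) ∧ ∀ n, ∀ v ∈ V n, T v ∈ V (n + 1)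

/-- `T` is a Hilbert-Schmidt operator: `∑ ‖T b_i‖² < ∞` for some orthonormal basis `b` (then for
every one). -/
def IsHilbertSchmidt {H : Type} [NormedAddCommGroup H] [InnerProductSpace ℂ H] [CompleteSpace H]
    (T : H →L[ℂ] H) : Prop :=
  ∃ (ι : Type) (b : HilbertBasis ι ℂ H), Summable fun i => ‖T (b i)‖ ^ 2

/-- `T` belongs to the Cowen-Douglas class `B_n(Ω)` (`Ω ⊆ ℂ` open and connected, `n ≥ 1`). -/
structure IsCowenDouglas (T : H →L[ℂ] H) (Ω : Set ℂ) (n : ℕ) : Prop where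
  subset_spectrum : Ω ⊆ spectrum ℂ T
  surjective : ∀ w ∈ Ω, Function.Surjective (T - w • ContinuousLinearMap.id ℂ H)
  dense : (⨆ w ∈ Ω, (T - w • ContinuousLinearMap.id ℂ H).ker).topologicalClosure = ⊤
  finite : ∀ w ∈ Ω, FiniteDimensional ℂ (T - w • ContinuousLinearMap.id ℂ H).ker
  finrank : ∀ w ∈ Ω, Module.finrank ℂ (T - w • ContinuousLinearMap.id ℂ H).ker = n

end Operators

end HomogShift

end

/-! By Leibniz, `(z f)^(i+1) = z f^(i+1) + (i+1) f^(i)`, so `z Γ_j f` differs from `Γ_j (z f)` only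
by derivatives of `f` of one order less in each component `ℓ > j`. Solving a unitriangular system
rewrites this defect as `∑_{k>j} c_{j,k} Γ_k f^(k-j-1)` (`smul_Gam_monomial`). In the orthonormal
basis `μ_j e_n^j` the diagonal weights are `√((n+1)/(2λ_j+n)) = 1 + O(1/n)`. The other weights come
from derivatives of order `d = k-j-1` while the parameter rises by `d+1`, hence are `O(1/n)`
(`exists_abs_entry_sub_le`).

Each `n` carries finitely many basis vectors, so these errors are square summable and define a
Hilbert–Schmidt, compact operator `K`. With the block shift `U`, an isometry, `M := U + K` is
bounded, and checking point evaluations on the basis shows that it is multiplication by `z`.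

For `|a| < 1`, `U - a` is bounded below and `M - a` is injective; compactness of `K` makes `M - a`
bounded below, so its adjoint is surjective. The kernel of `M* - conj a` consists of the kernel
functions at `a`. They are parametrized injectively by `ℂ^(m+1)` because the constants lie in the
space, and there are no further eigenvectors because the constants generate the space under `M`.
Density of the kernel functions then gives density of the eigenspaces. -/

noncomputable section

namespace HomogShift

/-! ### Compact perturbations, isometries and adjoints on a Hilbert space. -/

section Operators

variable {H : Type*} [NormedAddCommGroup H] [InnerProductSpace ℂ H] {ι : Type*}

/-- Cauchy–Schwarz followed by Bessel. It bounds the operator norm of a finite sum of rank-one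
operators by its Hilbert–Schmidt norm. -/
lemma norm_sum_inner_smul_le {b : ι → H} (hb : Orthonormal ℂ b) (v : ι → H) (s : Finset ι)
    (x : H) :
    ‖∑ i ∈ s, inner ℂ (b i) x • v i‖ ≤ √(∑ i ∈ s, ‖v i‖ ^ 2) * ‖x‖ := by
  calc ‖∑ i ∈ s, inner ℂ (b i) x • v i‖
      ≤ ∑ i ∈ s, ‖v i‖ * ‖inner ℂ (b i) x‖ :=
        (norm_sum_le _ _).trans_eq (Finset.sum_congr rfl fun i _ => by rw [norm_smul, mul_comm])
    _ ≤ √(∑ i ∈ s, ‖v i‖ ^ 2) * √(∑ i ∈ s, ‖inner ℂ (b i) x‖ ^ 2) :=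
        Real.sum_mul_le_sqrt_mul_sqrt _ _ _
    _ ≤ √(∑ i ∈ s, ‖v i‖ ^ 2) * ‖x‖ := by
        gcongr
        exact Real.sqrt_le_iff.2 ⟨norm_nonneg x, hb.sum_inner_products_le x⟩

/-- An operator with prescribed square summable values on an orthonormal family; it is compact. -/
lemma exists_isCompactOperator_of_summable_sq [CompleteSpace H] {b : ι → H} (hb : Orthonormal ℂ b) {v : ι → H}
    (hv : Summable fun i => ‖v i‖ ^ 2) :
    ∃ K : H →L[ℂ] H, (∀ i, K (b i) = v i) ∧ IsCompactOperator K := by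
  classical
  let R : ι → H →L[ℂ] H := fun i => (innerSL ℂ (b i)).smulRight (v i)
  have hR : ∀ i x, R i x = inner ℂ (b i) x • v i := fun i x => rfl
  have hnorm : ∀ s : Finset ι, ‖∑ i ∈ s, R i‖ ≤ √(∑ i ∈ s, ‖v i‖ ^ 2) := fun s =>
    ContinuousLinearMap.opNorm_le_bound _ (Real.sqrt_nonneg _) fun x => by
      simpa only [_root_.sum_apply, hR] using norm_sum_inner_smul_le hb v s x
  -- The series converges in operator norm because finite sums far out have small Hilbert–Schmidt
  -- norm; the limit is compact, being a norm limit of finite-rank operators.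
  have hsum : Summable R := by
    rw [summable_iff_vanishing_norm] at hv ⊢
    intro ε hε
    obtain ⟨s, hs⟩ := hv (ε ^ 2) (by positivity)
    refine ⟨s, fun t ht => (hnorm t).trans_lt ?_⟩
    rw [Real.sqrt_lt' hε]
    exact (Real.le_norm_self _).trans_lt (hs t ht)
  refine ⟨∑' i, R i, fun j => ?_, ?_⟩
  · have h := hsum.hasSum.mapL (ContinuousLinearMap.apply ℂ H (b j))
    refine h.unique ?_
    convert hasSum_ite_eq j (v j) using 2 with i
    rw [ContinuousLinearMap.apply_apply, hR, orthonormal_iff_ite.1 hb]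
    split_ifs with h <;> simp [h]
  · refine isCompactOperator_of_tendsto hsum.hasSum (Eventually.of_forall fun s => ?_)
    induction s using Finset.induction_on with
    | empty => simpa using isCompactOperator_zero
    | insert a s ha ih =>
      rw [Finset.sum_insert ha]
      refine IsCompactOperator.add ?_ ih
      exact (isCompactOperator_of_locallyCompactSpace_dom (innerSL ℂ (b a))).clm_comp
        (ContinuousLinearMap.toSpanSingleton ℂ (v a))

/-- The isometry that maps a Hilbert basis to an orthonormal family. -/
lemma exists_linearIsometry_of_orthonormal [CompleteSpace H] (b : HilbertBasis ι ℂ H) {v : ι → H}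
    (hv : Orthonormal ℂ v) : ∃ U : H →ₗᵢ[ℂ] H, ∀ i, U (b i) = v i := by
  classical
  refine ⟨hv.orthogonalFamily.linearIsometry.comp b.repr.toLinearIsometry, fun i => ?_⟩
  change hv.orthogonalFamily.linearIsometry (b.repr (b i)) = v i
  rw [b.repr_self, hv.orthogonalFamily.linearIsometry_apply_single]
  simp

/-- An injective compact perturbation of an operator that is bounded below is bounded below. -/
lemma exists_norm_le_of_isCompactOperator [CompleteSpace H] {A K : H →L[ℂ] H} {δ : ℝ} (hδ : 0 < δ)
    (hA : ∀ x, δ * ‖x‖ ≤ ‖A x‖) (hK : IsCompactOperator K)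
    (hinj : ∀ x, A x + K x = 0 → x = 0) :
    ∃ c > 0, ∀ x, c * ‖x‖ ≤ ‖A x + K x‖ := by
  by_contra! hcon
  have hseq : ∀ n : ℕ, ∃ x : H, ‖x‖ = 1 ∧ ‖A x + K x‖ < 1 / ((n : ℝ) + 1) := by
    intro n
    obtain ⟨x, hx⟩ := hcon (1 / ((n : ℝ) + 1)) (by positivity)
    have hx0 : x ≠ 0 := by rintro rfl; simp at hx
    have hx1 : 0 < ‖x‖ := norm_pos_iff.2 hx0
    refine ⟨((‖x‖⁻¹ : ℝ) : ℂ) • x, ?_, ?_⟩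
    · rw [norm_smul, Complex.norm_real, norm_inv, norm_norm, inv_mul_cancel₀ hx1.ne']
    · rw [map_smul, map_smul, ← smul_add, norm_smul, Complex.norm_real, norm_inv, norm_norm,
        inv_mul_lt_iff₀ hx1, mul_comm]
      exact hx
  choose x hx1 hx2 using hseq
  -- Compactness makes `K x_n` converge along a subsequence, so `A x_n` converges too. As `A` is
  -- bounded below, `x_n` is then Cauchy, and its limit is a unit vector killed by `A + K`.
  obtain ⟨y, -, φ, hφ, hy⟩ := (hK.isCompact_closure_image_closedBall (r := 1)).tendsto_subseq
    (x := fun n => K (x n)) fun n => subset_closure ⟨x n, by simp [hx1 n], rfl⟩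
  have hsum : Tendsto (fun n => A (x (φ n)) + K (x (φ n))) atTop (𝓝 0) :=
    (squeeze_zero_norm (fun n => (hx2 n).le) tendsto_one_div_add_atTop_nhds_zero_nat).comp
      hφ.tendsto_atTop
  have hAx : Tendsto (fun n => A (x (φ n))) atTop (𝓝 (0 - y)) := by
    refine (hsum.sub hy).congr fun n => ?_
    simp
  have hanti : AntilipschitzWith (Real.toNNReal δ⁻¹) A := by
    refine ContinuousLinearMap.antilipschitz_of_bound A fun x => ?_
    rw [Real.coe_toNNReal _ (by positivity), ← div_eq_inv_mul, le_div_iff₀ hδ, mul_comm]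
    exact hA x
  have hcau : CauchySeq fun n => x (φ n) := by
    have := hAx.cauchySeq
    rw [CauchySeq, ← (hanti.isUniformInducing A.uniformContinuous).cauchy_map_iff, map_map]
    exact this
  obtain ⟨x₀, hx₀⟩ := cauchySeq_tendsto_of_complete hcau
  have hz : A x₀ + K x₀ = 0 := by
    refine tendsto_nhds_unique ?_ hsum
    exact ((A.continuous.tendsto x₀).comp hx₀).add ((K.continuous.tendsto x₀).comp hx₀)
  have h1 : ‖x₀‖ = 1 :=
    tendsto_nhds_unique hx₀.norm (by simp [hx1])
  rw [hinj x₀ hz, norm_zero] at h1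
  exact zero_ne_one h1

/-- The adjoint of an operator that is bounded below is surjective. -/
lemma surjective_adjoint_of_norm_le [CompleteSpace H] {A : H →L[ℂ] H} {c : ℝ} (hc : 0 < c)
    (hA : ∀ x, c * ‖x‖ ≤ ‖A x‖) : Function.Surjective (ContinuousLinearMap.adjoint A) := by
  -- `⟪A* A x, x⟫ = ‖A x‖² ≥ c² ‖x‖²`, so `A* A` is coercive and hence invertible; `A (A* A)⁻¹ y` is
  -- a preimage of `y`.
  have hu : IsUnit (ContinuousLinearMap.adjoint A ∘L A) := by
    refine ContinuousLinearMap.isUnit_of_forall_le_norm_inner_map _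
      (c := ⟨c ^ 2, by positivity⟩) (by exact_mod_cast (by positivity : 0 < c ^ 2)) fun x => ?_
    rw [ContinuousLinearMap.comp_apply, ContinuousLinearMap.adjoint_inner_left,
      inner_self_eq_norm_sq_to_K, norm_pow]
    simp only [RCLike.norm_ofReal, abs_norm]
    change ‖x‖ ^ 2 * c ^ 2 ≤ _
    rw [mul_comm, ← mul_pow]
    exact pow_le_pow_left₀ (by positivity) (hA x) 2
  intro y
  obtain ⟨u, hu⟩ := hu
  refine ⟨A ((↑u⁻¹ : H →L[ℂ] H) y), ?_⟩
  have h : (↑u * ↑u⁻¹ : H →L[ℂ] H) y = y := by simp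
  rw [hu] at h
  exact h

lemma clm_ext_hilbertBasis {b : HilbertBasis ι ℂ H} {E : Type*} [NormedAddCommGroup E]
    [NormedSpace ℂ E] {f g : H →L[ℂ] E} (h : ∀ i, f (b i) = g (b i)) : f = g := by
  refine ContinuousLinearMap.ext_on (s := Set.range b) ?_ ?_
  · rw [dense_iff_closure_eq, ← Submodule.topologicalClosure_coe, b.dense_span,
      Submodule.top_coe]
  · rintro _ ⟨i, rfl⟩
    exact h i

end Operators

/-! ### Pochhammer symbols, triangular systems and estimates of the weights. -/

section Scalars

lemma poch_add (x : ℝ) (a b : ℕ) : poch x (a + b) = poch x a * poch (x + a) b := by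
  simp only [poch, ← ascPochhammer_mul ℝ a b, Polynomial.eval_mul, Polynomial.eval_comp]
  simp

lemma poch_succ (x : ℝ) (n : ℕ) : poch x (n + 1) = poch x n * (x + n) := by
  rw [poch_add]; simp [poch]

lemma pow_le_poch {x : ℝ} (hx : 0 ≤ x) (n : ℕ) : x ^ n ≤ poch x n := by
  induction n with
  | zero => simp [poch]
  | succ n ih =>
    rw [poch_succ, pow_succ]
    have h : (0 : ℝ) ≤ n := n.cast_nonneg
    exact mul_le_mul ih (by linarith) hx ((pow_nonneg hx n).trans ih)

/-- The solution `c` of the triangular system `c l + ∑_{k < l} a l k * c k = r l`. -/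
def triSol (a : ℕ → ℕ → ℝ) (r : ℕ → ℝ) (l : ℕ) : ℝ :=
  r l - ∑ k : Fin l, a l k * triSol a r k
termination_by l
decreasing_by exact k.2

lemma triSol_add_sum (a : ℕ → ℕ → ℝ) (r : ℕ → ℝ) (l : ℕ) :
    triSol a r l + ∑ k ∈ Finset.range l, a l k * triSol a r k = r l := by
  rw [triSol, Finset.sum_range (fun k => a l k * triSol a r k)]
  ring

lemma triSol_eq_zero (a : ℕ → ℕ → ℝ) {r : ℕ → ℝ} {j : ℕ} (hr : ∀ l ≤ j, r l = 0) :
    ∀ l ≤ j, triSol a r l = 0 := by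
  intro l
  induction l using Nat.strong_induction_on with
  | _ l ih =>
    intro hl
    rw [triSol, hr l hl, Finset.sum_eq_zero, sub_zero]
    intro k _
    rw [ih k k.2 (k.2.le.trans hl), mul_zero]

lemma sq_coef {ν : ℝ} (hν : 0 < ν) (n : ℕ) : coef ν n ^ 2 = poch (2 * ν) n / n.factorial :=
  Real.sq_sqrt (div_pos (poch_pos (by positivity) n) (by positivity)).le

lemma sq_coef_div_coef_succ {ν : ℝ} (hν : 0 < ν) (n : ℕ) :
    (coef ν n / coef ν (n + 1)) ^ 2 = (n + 1) / (2 * ν + n) := by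
  have h1 := poch_pos (x := 2 * ν) (by positivity) n
  have h2 : (0 : ℝ) < 2 * ν + n := by positivity
  rw [div_pow, sq_coef hν, sq_coef hν, poch_succ, Nat.factorial_succ]
  push_cast
  field_simp

/-- For the weight `t`, `t² - 1 = (1 - 2ν)/(2ν + n)`, and `|t - 1| ≤ |t - 1| (t + 1) = |t² - 1|`
since `t > 0`. -/
lemma abs_coef_div_coef_succ_sub_one_le {ν : ℝ} (hν : 0 < ν) (n : ℕ) :
    |coef ν n / coef ν (n + 1) - 1| ≤ |1 - 2 * ν| / (2 * ν + n) := by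
  set t := coef ν n / coef ν (n + 1) with ht
  have ht0 : 0 < t := div_pos (coef_pos hν _) (coef_pos hν _)
  have h2 : (0 : ℝ) < 2 * ν + n := by positivity
  have h : |1 - 2 * ν| / (2 * ν + n) = |t - 1| * (t + 1) := by
    have h3 : |1 - 2 * ν| / (2 * ν + n) = |(1 - 2 * ν) / (2 * ν + n)| := by
      rw [abs_div, abs_of_pos h2]
    have h4 : |t - 1| * (t + 1) = |(t - 1) * (t + 1)| := by
      rw [abs_mul, abs_of_pos (show 0 < t + 1 by linarith)]
    rw [h3, h4]
    congr 1
    have := sq_coef_div_coef_succ hν n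
    rw [← ht] at this
    rw [show (t - 1) * (t + 1) = t ^ 2 - 1 by ring, this]
    field_simp
    ring
  rw [h]
  nlinarith [abs_nonneg (t - 1)]

/-- The `d`-th derivative from the space with parameter `ν` to that with parameter `ν + d + 1`
multiplies normalized monomials by weights of order `1 / n`. -/
lemma coef_mul_descFactorial_div_coef_le {ν : ℝ} (hν : 0 < ν) (d n : ℕ) :
    coef ν n * n.descFactorial d / coef (ν + (d + 1)) (n - d) ≤
      √(poch (2 * ν) (2 * d + 2)) / (2 * ν + n) := by
  have hn : (0 : ℝ) < 2 * ν + n := by positivity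
  have hc := poch_pos (x := 2 * ν) (by positivity) (2 * d + 2)
  rcases lt_or_ge n d with hnd | hnd
  · rw [Nat.descFactorial_of_lt hnd]
    simp only [Nat.cast_zero, mul_zero, zero_div]
    positivity
  have h1 := coef_pos hν n
  have h2 := coef_pos (ν := ν + (d + 1)) (by positivity) (n - d)
  refine le_of_sq_le_sq ?_ (by positivity)
  have hf : (n.factorial : ℝ) = (n - d).factorial * n.descFactorial d := by
    exact_mod_cast (Nat.factorial_mul_descFactorial hnd).symm
  have hp := poch_pos (x := 2 * ν) (by positivity) n
  have hq := poch_pos (x := 2 * (ν + (d + 1))) (by positivity) (n - d)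
  have hr := poch_pos hn (d + 2)
  -- Two splittings of `(2ν)_(n+d+2)`, at `2d + 2` and at `n`.
  have hPQ : poch (2 * ν) (2 * d + 2) * poch (2 * (ν + (d + 1))) (n - d) =
      poch (2 * ν) n * poch (2 * ν + n) (d + 2) := by
    rw [show 2 * (ν + (d + 1)) = 2 * ν + ((2 * d + 2 : ℕ) : ℝ) by push_cast; ring, ← poch_add,
      ← poch_add, show n + (d + 2) = (2 * d + 2) + (n - d) by omega]
  have hD0 : (0 : ℝ) < n.descFactorial d := by
    exact_mod_cast Nat.descFactorial_pos.2 hnd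
  -- The `d` factors on the left are at most `n`, while all `d + 2` factors on the right are at
  -- least `2ν + n`; the two extra factors give the decay of the square.
  have hD : (n.descFactorial d : ℝ) * (2 * ν + n) ^ 2 ≤ poch (2 * ν + n) (d + 2) := by
    calc (n.descFactorial d : ℝ) * (2 * ν + n) ^ 2 ≤ (2 * ν + n) ^ d * (2 * ν + n) ^ 2 := by
          gcongr
          calc (n.descFactorial d : ℝ) ≤ (n : ℝ) ^ d := by exact_mod_cast n.descFactorial_le_pow d
            _ ≤ _ := by gcongr; linarith
      _ ≤ _ := by rw [← pow_add]; exact pow_le_poch hn.le _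
  have hL : (coef ν n * n.descFactorial d / coef (ν + (d + 1)) (n - d)) ^ 2 =
      n.descFactorial d * poch (2 * ν) (2 * d + 2) / poch (2 * ν + n) (d + 2) := by
    rw [div_pow, mul_pow, sq_coef hν, sq_coef (by positivity), hf]
    rw [eq_div_iff hr.ne', div_mul_eq_mul_div, div_eq_iff (by positivity)]
    have : ((n - d).factorial : ℝ) ≠ 0 := by positivity
    field_simp
    linear_combination -hPQ
  rw [hL, div_pow, Real.sq_sqrt hc.le, div_le_div_iff₀ hr (by positivity), mul_right_comm,
    mul_comm (poch (2 * ν) _)]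
  exact mul_le_mul_of_nonneg_right hD hc.le

end Scalars

/-! ### Multiplication by `z` against the operators `Γ_k`, on monomials. -/

/-- The derivatives of the monomials. -/
lemma derivDisc_monomial (ν : {x : ℝ // 0 < x}) (k n : ℕ) (z : Complex.UnitDisc) :
    derivDisc k (monomial ν n) z = n.descFactorial k * (z : ℂ) ^ (n - k) := by
  have h : ext0 (monomial ν n) =ᶠ[𝓝 (z : ℂ)] fun x => x ^ n := by
    have : Metric.ball (0 : ℂ) 1 ∈ 𝓝 (z : ℂ) :=
      Metric.isOpen_ball.mem_nhds (by simpa using z.norm_lt_one)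
    filter_upwards [this] with x hx
    have hx' : ‖x‖ < 1 := by simpa using hx
    rw [ext0, dif_pos hx', monomial_apply, Complex.UnitDisc.coe_mk]
  rw [derivDisc, h.iteratedDeriv_eq, iteratedDeriv_pow]

variable {m : ℕ} (p : Params m)

/-- The coefficient of the `(l - j)`-th derivative in the component `l` of `Γ_j`. -/
def gamCoef (j l : ℕ) : ℝ := l.choose j / poch (2 * p.lam - m + 2 * j) (l - j)

lemma two_mul_lamj (j : Fin (m + 1)) : 2 * (p.lamj j : ℝ) = 2 * p.lam - m + 2 * (j : ℕ) := by
  simp only [Params.lamj]; ring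

lemma gamCoef_self (j : ℕ) : gamCoef p j j = 1 := by simp [gamCoef, poch]

lemma gamCoef_of_lt {j l : ℕ} (h : l < j) : gamCoef p j l = 0 := by
  simp [gamCoef, Nat.choose_eq_zero_of_lt h]

lemma Gam_monomial_apply (j l : Fin (m + 1)) (n : ℕ) (z : Complex.UnitDisc) :
    Gam p j (monomial (p.lamj j) n) z l =
      gamCoef p j l * (n.descFactorial (l - j) * (z : ℂ) ^ (n - (l - j))) := by
  rcases lt_or_ge l j with h | h
  · simp [Gam, not_le.2 h, gamCoef_of_lt p h]
  · simp only [Gam, h, if_true, derivDisc_monomial, gamCoef, two_mul_lamj]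

/-- The coefficients in `z Γ_j f = Γ_j (z f) + ∑_{k > j} c_{j,k} Γ_k f^(k - j - 1)`. -/
def corr (j k : ℕ) : ℝ :=
  triSol (fun l k => gamCoef p k l) (fun l => -((l - j : ℕ) * gamCoef p j l)) k

lemma corr_of_le {j k : ℕ} (h : k ≤ j) : corr p j k = 0 :=
  triSol_eq_zero _ (j := j) (fun l hl => by simp [Nat.sub_eq_zero_of_le hl]) k h

/-- Component `l` of every `Γ_k f^(k-j-1)` is a multiple of the same derivative `f^(l-j-1)`, so one
scalar equation per `l` suffices. The right side is the Leibniz defect of `Γ_j (z f)`. The terms `k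
> l` vanish and the diagonal is `1`, so forward substitution solves the system. -/
lemma sum_gamCoef_mul_corr (j l : Fin (m + 1)) :
    ∑ k : Fin (m + 1), gamCoef p k l * corr p j k = -((l - j : ℕ) * gamCoef p j l) := by
  rw [Fin.sum_univ_eq_sum_range (fun k => gamCoef p k l * corr p j k),
    ← triSol_add_sum (fun l k => gamCoef p k l) (fun l => -((l - j : ℕ) * gamCoef p j l)) l,
    ← Finset.sum_subset (s₁ := Finset.range (l + 1)), Finset.sum_range_succ, add_comm,
    gamCoef_self, one_mul]
  · rfl
  · exact Finset.range_subset_range.2 l.2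
  · intro k _ hk
    rw [gamCoef_of_lt p (by simpa [Nat.lt_succ_iff] using hk), zero_mul]

/-- The Leibniz rule for the derivative of order `i + 1` of `z · z^n`, read on coefficients. -/
lemma succ_descFactorial_succ_eq (n i : ℕ) :
    (n + 1).descFactorial (i + 1) = n.descFactorial (i + 1) + (i + 1) * n.descFactorial i := by
  rw [Nat.succ_descFactorial_succ, Nat.descFactorial_succ, ← add_mul]
  rcases lt_or_ge n i with h | h
  · simp [Nat.descFactorial_of_lt h]
  · congr 1
    omega

/-- Multiplication by `z` in terms of the operators `Γ_k`, on monomials. -/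
lemma smul_Gam_monomial (j : Fin (m + 1)) (n : ℕ) (z : Complex.UnitDisc) :
    (z : ℂ) • Gam p j (monomial (p.lamj j) n) z =
      Gam p j (monomial (p.lamj j) (n + 1)) z +
        ∑ k : Fin (m + 1), ((corr p j k * n.descFactorial (k - j - 1) : ℝ) : ℂ) •
          Gam p k (monomial (p.lamj k) (n - (k - j - 1))) z := by
  ext l
  simp only [PiLp.smul_apply, PiLp.add_apply, WithLp.ofLp_sum, Finset.sum_apply, smul_eq_mul,
    Gam_monomial_apply]
  rcases le_or_gt l j with h | h
  · have h' : (l : ℕ) ≤ j := h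
    rw [Finset.sum_eq_zero, add_zero, Nat.sub_eq_zero_of_le h']
    · simp only [Nat.descFactorial_zero, Nat.cast_one, one_mul, tsub_zero]
      ring
    · intro k _
      rcases le_or_gt (k : ℕ) j with hk | hk
      · simp [corr_of_le p hk]
      · simp [gamCoef_of_lt p (h'.trans_lt hk)]
  · obtain ⟨i, hi⟩ : ∃ i : ℕ, (l : ℕ) = j + i + 1 := ⟨l - j - 1, by have : (j : ℕ) < l := h; omega⟩
    -- Differentiating `k - j - 1` times and then `l - k` times is differentiating `i = l - j - 1`
    -- times, independently of `k`.
    have hsum : ∑ k : Fin (m + 1), ((corr p j k * n.descFactorial (k - j - 1) : ℝ) : ℂ) *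
          (gamCoef p k l * ((n - (k - j - 1)).descFactorial (l - k) *
            (z : ℂ) ^ (n - (k - j - 1) - (l - k)))) =
        ((∑ k : Fin (m + 1), gamCoef p k l * corr p j k : ℝ) : ℂ) *
          (n.descFactorial i * (z : ℂ) ^ (n - i)) := by
      rw [Complex.ofReal_sum, Finset.sum_mul]
      refine Finset.sum_congr rfl fun k _ => ?_
      rcases le_or_gt (k : ℕ) j with hk | hk
      · simp [corr_of_le p hk]
      rcases lt_or_ge (l : ℕ) k with hlk | hlk
      · simp [gamCoef_of_lt p hlk]
      have h1 : n - (k - j - 1) - (l - k) = n - i := by omega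
      have h2 : n.descFactorial i =
          n.descFactorial (k - j - 1) * (n - (k - j - 1)).descFactorial (l - k) := by
        rw [← Nat.descFactorial_mul_descFactorial (show (k : ℕ) - j - 1 ≤ i by omega), mul_comm,
          show i - (k - j - 1) = (l : ℕ) - k by omega]
      rw [h1, h2]
      push_cast
      ring
    rw [hsum, sum_gamCoef_mul_corr, show (l : ℕ) - j = i + 1 by omega,
      succ_descFactorial_succ_eq, show n + 1 - (i + 1) = n - i by omega]
    -- For `n ≤ i` truncation breaks `z · z^(n-(i+1)) = z^(n-i)`, but the factor `n.descFactorial (i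
    -- + 1)` is then zero.
    rcases lt_or_ge i n with hin | hin
    · rw [show n - i = n - (i + 1) + 1 by omega, pow_succ]
      push_cast
      ring
    · rw [Nat.descFactorial_of_lt (Nat.lt_succ_of_le hin)]
      push_cast
      ring

/-! ### The orthonormal basis and the decomposition into the spaces `H(n)`. -/

section Basis

lemma mu_ne_zero (j : Fin (m + 1)) : (p.mu j : ℂ) ≠ 0 := by exact_mod_cast (p.mu_pos j).ne'

lemma coef_lamj_ne_zero (j : Fin (m + 1)) (n : ℕ) : (coef (p.lamj j) n : ℂ) ≠ 0 := by
  exact_mod_cast (coef_pos (p.lamj j).2 n).ne'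

lemma inner_mu_e (j : Fin (m + 1)) (n : ℕ) (F : VecSpace p) :
    inner ℂ ((p.mu j : ℂ) • e p j n) F = (F.comp j).coeff n := by
  have hin : ∀ F G : VecSpace p, inner ℂ F G = ∑ j, inner ℂ (F.comp j) (G.comp j) :=
    fun F G => PiLp.inner_apply (𝕜 := ℂ) _ _
  rw [hin, Finset.sum_eq_single j]
  · have h : ((p.mu j : ℂ) • e p j n).comp j = (lp.single 2 n (1 : ℂ) : lp (fun _ : ℕ => ℂ) 2) := by
      rw [comp_smul, e, embed_comp_self, smul_smul, mul_inv_cancel₀ (mu_ne_zero p j), one_smul]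
      refine (lp.single_smul 2 n _ _).symm.trans ?_
      rw [smul_eq_mul, Complex.ofReal_inv, mul_inv_cancel₀ (coef_lamj_ne_zero p j n)]
    rw [h]
    refine (lp.inner_single_left (𝕜 := ℂ) (G := fun _ : ℕ => ℂ) n 1 _).trans ?_
    simp [DiscSpace.coeff]
  · intro i _ hi
    rw [comp_smul, e, embed_comp_ne hi, smul_zero, inner_zero_left]
  · simp

/-- The orthonormal basis of the vectors `μ_j e_n^j`. -/
def basis : HilbertBasis (Fin (m + 1) × ℕ) ℂ (VecSpace p) :=
  HilbertBasis.mkOfOrthogonalEqBot (orthonormal_mu_e p) (by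
    rw [Submodule.eq_bot_iff]
    intro F hF
    rw [Submodule.mem_orthogonal] at hF
    have h : ∀ j, F.comp j = 0 := fun j => coeff_ext fun n => by
      rw [← inner_mu_e]
      exact hF _ (Submodule.subset_span ⟨(j, n), rfl⟩)
    rw [eq_sum_embed F]
    refine Finset.sum_eq_zero fun j _ => ?_
    rw [h j, smul_zero]
    exact RKHS.ext fun z => by rw [embed_apply, Gam_zero, RKHS.coe_zero, Pi.zero_apply])

lemma basis_apply (j : Fin (m + 1)) (n : ℕ) : basis p (j, n) = (p.mu j : ℂ) • e p j n := by
  rw [basis, HilbertBasis.coe_mkOfOrthogonalEqBot]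

lemma e_eq_smul_basis (j : Fin (m + 1)) (n : ℕ) : e p j n = (p.mu j : ℂ)⁻¹ • basis p (j, n) := by
  rw [basis_apply, smul_smul, inv_mul_cancel₀ (mu_ne_zero p j), one_smul]

lemma e_apply (j : Fin (m + 1)) (n : ℕ) (z : Complex.UnitDisc) :
    e p j n z = (coef (p.lamj j) n : ℂ) • Gam p j (monomial (p.lamj j) n) z := by
  rw [e, embed_apply, Gam_smul]

lemma sum_apply_unitDisc {ι : Type*} (s : Finset ι) (G : ι → VecSpace p) (z : Complex.UnitDisc) :
    (∑ i ∈ s, G i) z = ∑ i ∈ s, G i z := by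
  rw [← RKHS.coeCLM_apply, map_sum, Finset.sum_apply]
  rfl

/-- Evaluation at a point of the disc. -/
def evalCLM (z : Complex.UnitDisc) : VecSpace p →L[ℂ] EuclideanSpace ℂ (Fin (m + 1)) :=
  ContinuousLinearMap.proj z ∘L RKHS.coeCLM ℂ

lemma e_mem_blockSpace {j : Fin (m + 1)} {n i : ℕ} (h : i + j = n) : e p j i ∈ blockSpace p n :=
  Submodule.subset_span ⟨j, by omega, by rw [show n - j = i by omega]⟩

/-- `H(n)` is spanned by the `e_i^j` with `i + j = n`, so different `n` use disjoint parts of the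
orthonormal basis, and every basis vector occurs. -/
lemma isHilbertSum_blockSpace :
    IsHilbertSum ℂ (fun n => blockSpace p n) (fun n => (blockSpace p n).subtypeₗᵢ) := by
  have : ∀ n, CompleteSpace (blockSpace p n) := fun n => by
    have hfin : {v | ∃ j : Fin (m + 1), (j : ℕ) ≤ n ∧ v = e p j (n - j)}.Finite :=
      (Set.finite_range fun j : Fin (m + 1) => e p j (n - j)).subset
        fun v ⟨j, _, hv⟩ => ⟨j, hv.symm⟩
    have : FiniteDimensional ℂ (blockSpace p n) := FiniteDimensional.span_of_finite ℂ hfin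
    exact FiniteDimensional.complete ℂ _
  refine IsHilbertSum.mkInternal _ (OrthogonalFamily.of_pairwise fun n k hnk => ?_) ?_
  · refine Submodule.isOrtho_span.2 ?_
    rintro _ ⟨j, hj, rfl⟩ _ ⟨i, hi, rfl⟩
    rw [e_eq_smul_basis, e_eq_smul_basis, inner_smul_left, inner_smul_right,
      (basis p).orthonormal.2, mul_zero, mul_zero]
    intro h
    rw [Prod.mk.injEq] at h
    obtain ⟨rfl, h⟩ := h
    omega
  · rw [← (basis p).dense_span]
    refine Submodule.topologicalClosure_mono (Submodule.span_le.2 ?_)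
    rintro _ ⟨⟨j, n⟩, rfl⟩
    rw [basis_apply]
    exact Submodule.smul_mem _ _
      (Submodule.mem_iSup_of_mem (n + j) (e_mem_blockSpace p rfl))

end Basis

/-! ### Matrix entries of `M` and their decay. -/

section Entries

/-- The entry at `(k, j)` of the block `M(n + j)`. -/
def entry (k j : Fin (m + 1)) (n : ℕ) : ℝ :=
  if k = j then coef (p.lamj j) n / coef (p.lamj j) (n + 1)
  else p.mu j / p.mu k * corr p j k *
    (coef (p.lamj j) n * n.descFactorial (k - j - 1) / coef (p.lamj k) (n - (k - j - 1)))

lemma entry_self (j : Fin (m + 1)) (n : ℕ) :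
    entry p j j n = coef (p.lamj j) n / coef (p.lamj j) (n + 1) := if_pos rfl

lemma entry_of_ne {k j : Fin (m + 1)} (h : k ≠ j) (n : ℕ) :
    entry p k j n = p.mu j / p.mu k * corr p j k *
      (coef (p.lamj j) n * n.descFactorial (k - j - 1) / coef (p.lamj k) (n - (k - j - 1))) :=
  if_neg h

/-- The derivative of order `k - j - 1 > n` kills `z^n`. This makes the truncated index `n + 1 + j -
k` harmless and confines the image to `k ≤ n + j + 1`. -/
lemma entry_eq_zero {k j : Fin (m + 1)} {n : ℕ} (h : n + j + 1 < k) : entry p k j n = 0 := by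
  have hkj : k ≠ j := by rintro rfl; omega
  rw [entry_of_ne p hkj, Nat.descFactorial_of_lt (by omega)]
  simp

/-- With `d = k - j - 1` the parameter rises by exactly `d + 1`, as
`coef_mul_descFactorial_div_coef_le` requires. -/
lemma lamj_eq_add {k j : Fin (m + 1)} (h : (j : ℕ) < k) :
    (p.lamj k : ℝ) = p.lamj j + ((k - j - 1 : ℕ) + 1) := by
  obtain ⟨d, hd⟩ : ∃ d : ℕ, (k : ℕ) = j + d + 1 := ⟨k - j - 1, by omega⟩
  simp only [Params.lamj, hd, show (j : ℕ) + d + 1 - j - 1 = d by omega]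
  push_cast
  ring

lemma div_add_le_div_succ {a x : ℝ} (ha : 0 ≤ a) (hx : 0 < x) (n : ℕ) :
    a / (x + n) ≤ a * (1 + 1 / x) / (n + 1) := by
  have hn : (0 : ℝ) ≤ n := n.cast_nonneg
  rw [div_le_div_iff₀ (by positivity) (by positivity), mul_assoc]
  refine mul_le_mul_of_nonneg_left ?_ ha
  have h : (1 + 1 / x) * (x + n) = n + 1 + (x + n / x) := by field_simp; ring
  rw [h]
  have : 0 ≤ (n : ℝ) / x := by positivity
  linarith

lemma exists_abs_entry_sub_le (k j : Fin (m + 1)) :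
    ∃ C : ℝ, 0 ≤ C ∧ ∀ n : ℕ, |entry p k j n - if k = j then 1 else 0| ≤ C / (n + 1) := by
  have hx : (0 : ℝ) < 2 * p.lamj j := mul_pos two_pos (p.lamj j).2
  rcases eq_or_ne k j with rfl | hkj
  · refine ⟨|1 - 2 * (p.lamj k : ℝ)| * (1 + 1 / (2 * p.lamj k)), by positivity, fun n => ?_⟩
    rw [entry_self, if_pos rfl]
    exact (abs_coef_div_coef_succ_sub_one_le (p.lamj k).2 n).trans
      (div_add_le_div_succ (abs_nonneg _) hx n)
  rcases le_or_gt (k : ℕ) j with hlt | hlt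
  · refine ⟨0, le_rfl, fun n => ?_⟩
    rw [entry_of_ne p hkj, corr_of_le p hlt]
    simp [hkj]
  · set a := |p.mu j / p.mu k * corr p j k|
    set s := √(poch (2 * p.lamj j) (2 * (k - j - 1 : ℕ) + 2))
    refine ⟨a * (s * (1 + 1 / (2 * p.lamj j))), by positivity, fun n => ?_⟩
    rw [entry_of_ne p hkj, if_neg hkj, sub_zero, abs_mul, mul_div_assoc a]
    refine mul_le_mul_of_nonneg_left ?_ (abs_nonneg _)
    rw [abs_of_nonneg (div_nonneg (mul_nonneg (coef_pos (p.lamj j).2 n).le (Nat.cast_nonneg _))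
      (coef_pos (p.lamj k).2 _).le), lamj_eq_add p hlt]
    exact (coef_mul_descFactorial_div_coef_le (p.lamj j).2 _ n).trans
      (div_add_le_div_succ (Real.sqrt_nonneg _) hx n)

/-- Stated pointwise, before any bounded operator `M` is available; it later identifies `U + K` with
multiplication by `z`. -/
lemma smul_basis_apply (j : Fin (m + 1)) (n : ℕ) (z : Complex.UnitDisc) :
    (z : ℂ) • basis p (j, n) z =
      (∑ k : Fin (m + 1), (entry p k j n : ℂ) • basis p (k, n + 1 + j - k)) z := by
  rw [sum_apply_unitDisc]
  simp only [basis_apply, RKHS.coe_smul, Pi.smul_apply, e_apply]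
  rw [smul_comm, smul_comm (z : ℂ), smul_Gam_monomial, smul_add, smul_add,
    ← Finset.add_sum_erase _ (fun k => (entry p k j n : ℂ) • _) (Finset.mem_univ j)]
  congr 1
  · rw [entry_self, show n + 1 + (j : ℕ) - j = n + 1 by omega]
    simp only [smul_smul]
    congr 1
    have := coef_lamj_ne_zero p j (n + 1)
    push_cast
    field_simp
  · rw [← Finset.add_sum_erase _ _ (Finset.mem_univ j), corr_of_le p le_rfl]
    simp only [zero_mul, Complex.ofReal_zero, zero_smul, zero_add, Finset.smul_sum]
    refine Finset.sum_congr rfl fun k hk => ?_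
    have hkj : k ≠ j := Finset.ne_of_mem_erase hk
    rw [entry_of_ne p hkj]
    rcases le_or_gt (k : ℕ) j with hlt | hlt
    · simp [corr_of_le p hlt]
    rcases lt_or_ge n (k - j - 1) with hn | hn
    · simp [Nat.descFactorial_of_lt hn]
    rw [show n + 1 + (j : ℕ) - k = n - (k - j - 1) by omega]
    simp only [smul_smul]
    congr 1
    have h1 := coef_lamj_ne_zero p k (n - (k - j - 1))
    have h2 := mu_ne_zero p k
    push_cast
    field_simp

/-- The operator of multiplication by the coordinate function is a Hilbert-Schmidt perturbation
of the block unilateral shift. -/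
lemma exists_mulOperator : ∃ (U : VecSpace p →ₗᵢ[ℂ] VecSpace p) (K : VecSpace p →L[ℂ] VecSpace p),
    (∀ j n, U (basis p (j, n)) = basis p (j, n + 1)) ∧
    (∀ j n, U (basis p (j, n)) + K (basis p (j, n)) =
      ∑ k : Fin (m + 1), (entry p k j n : ℂ) • basis p (k, n + 1 + j - k)) ∧
    IsHilbertSchmidt K ∧ IsCompactOperator K := by
  obtain ⟨U, hU⟩ := exists_linearIsometry_of_orthonormal (basis p)
    ((basis p).orthonormal.comp (fun a : Fin (m + 1) × ℕ => (a.1, a.2 + 1)) (by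
      rintro ⟨i, a⟩ ⟨j, b⟩ h
      simpa using h))
  -- The prescribed values of `K = M - U`: the identity part of the blocks is removed because `U`
  -- already provides it.
  let v : Fin (m + 1) × ℕ → VecSpace p := fun a => ∑ k : Fin (m + 1),
    (((entry p k a.1 a.2 - if k = a.1 then 1 else 0 : ℝ)) : ℂ) • basis p (k, a.2 + 1 + a.1 - k)
  choose C hC0 hC using exists_abs_entry_sub_le p
  have hbound : ∀ a, ‖v a‖ ≤ (∑ k, C k a.1) / ((a.2 : ℝ) + 1) := fun a => by
    rw [Finset.sum_div]
    refine (norm_sum_le _ _).trans (Finset.sum_le_sum fun k _ => ?_)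
    rw [norm_smul, (basis p).orthonormal.1, mul_one, Complex.norm_real, Real.norm_eq_abs]
    exact hC k a.1 a.2
  have hv : Summable fun a => ‖v a‖ ^ 2 := by
    have hs : Summable fun n : ℕ => 1 / ((n : ℝ) + 1) ^ 2 := by
      exact_mod_cast (summable_nat_add_iff 1).2 (Real.summable_one_div_nat_pow.2 one_lt_two)
    rw [summable_prod_of_nonneg fun a => sq_nonneg _]
    refine ⟨fun j => ?_, Summable.of_finite⟩
    refine Summable.of_nonneg_of_le (fun n => sq_nonneg _) (fun n => ?_)
      (hs.mul_left ((∑ k, C k j) ^ 2))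
    rw [mul_one_div, ← div_pow]
    exact pow_le_pow_left₀ (norm_nonneg _) (hbound (j, n)) 2
  obtain ⟨K, hK, hKc⟩ := exists_isCompactOperator_of_summable_sq (basis p).orthonormal hv
  refine ⟨U, K, fun j n => hU (j, n), fun j n => ?_, ⟨_, basis p, by simpa only [hK] using hv⟩,
    hKc⟩
  rw [hU, hK]
  simp only [v, Complex.ofReal_sub, sub_smul, Finset.sum_sub_distrib]
  rw [Finset.sum_eq_single (f := fun k => (((if k = j then 1 else 0 : ℝ)) : ℂ) •
    basis p (k, n + 1 + j - k)) j (fun k _ hk => by simp [hk]) (by simp)]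
  simp

end Entries

/-! ### Eigenspaces of the adjoint and the Cowen–Douglas class. -/

section CowenDouglas

variable {p}

lemma continuousAt_iteratedDeriv_ext0 {ν : {x : ℝ // 0 < x}} (k : ℕ) (f : DiscSpace ν)
    (z : Complex.UnitDisc) : ContinuousAt (iteratedDeriv k (ext0 f)) z := by
  rw [iteratedDeriv_eq_iterate]
  exact ((analyticAt_discSpace f z).iterated_deriv k).continuousAt

/-- A function of the space that vanishes off one point vanishes. -/
lemma eq_zero_of_forall_ne {F : VecSpace p} {a : Complex.UnitDisc} (h : ∀ z, z ≠ a → F z = 0) :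
    F = 0 := by
  refine RKHS.ext fun z => ?_
  rw [RKHS.coe_zero, Pi.zero_apply]
  rcases ne_or_eq z a with hz | rfl
  · exact h z hz
  ext l
  -- Component `l` of `F`, extended to the plane so as to be continuous at `z`; its value there is
  -- the limit of the zeros around it.
  let g : ℂ → ℂ := fun x => ∑ j, (p.mu j : ℂ) * if j ≤ l then
    (((l : ℕ).choose j / poch (2 * p.lamj j) (l - j) : ℝ) : ℂ) *
      iteratedDeriv (l - j) (ext0 (F.comp j)) x else 0
  have hg : ∀ x : Complex.UnitDisc, g x = F x l := fun x => by
    simp only [g, vecSpace_apply, WithLp.ofLp_sum, Finset.sum_apply, PiLp.smul_apply, smul_eq_mul,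
      Gam, derivDisc]
  have hc : ContinuousAt g z := by
    refine tendsto_finsetSum _ fun j _ => ?_
    split_ifs
    · exact (continuousAt_const.mul
        (continuousAt_const.mul (continuousAt_iteratedDeriv_ext0 _ _ z)) :)
    · exact continuousAt_const
  have h0 : g =ᶠ[𝓝[≠] (z : ℂ)] fun _ => 0 := by
    have : Metric.ball (0 : ℂ) 1 ∈ 𝓝 (z : ℂ) :=
      Metric.isOpen_ball.mem_nhds (by simpa using z.norm_lt_one)
    filter_upwards [mem_nhdsWithin_of_mem_nhds this, self_mem_nhdsWithin] with x hx hxz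
    have hx' : ‖x‖ < 1 := by simpa using hx
    have := hg (.mk x hx')
    rw [h _ (fun hh => hxz (by rw [← hh]; rfl))] at this
    exact this
  rw [← hg]
  exact tendsto_nhds_unique (hc.mono_left nhdsWithin_le_nhds) (tendsto_const_nhds.congr' h0.symm)

variable {M : VecSpace p →L[ℂ] VecSpace p}

lemma pow_mulOperator_apply (hM : ∀ (F : VecSpace p) (z : Complex.UnitDisc), M F z = (z : ℂ) • F z)
    (i : ℕ) (F : VecSpace p) (z : Complex.UnitDisc) : (M ^ i) F z = (z : ℂ) ^ i • F z := by
  induction i with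
  | zero => simp
  | succ i ih => rw [pow_succ', mul_apply_eq_comp, hM, ih, smul_smul, pow_succ']

lemma mulOperator_sub_injective
    (hM : ∀ (F : VecSpace p) (z : Complex.UnitDisc), M F z = (z : ℂ) • F z)
    (a : Complex.UnitDisc) {F : VecSpace p} (h : M F = (a : ℂ) • F) : F = 0 := by
  refine eq_zero_of_forall_ne (a := a) fun z hz => ?_
  have h1 : (z : ℂ) • F z = (a : ℂ) • F z := by
    rw [← hM, h, RKHS.coe_smul, Pi.smul_apply]
  rw [← sub_eq_zero, ← sub_smul, smul_eq_zero, sub_eq_zero] at h1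
  exact h1.resolve_left fun h2 => hz (Complex.UnitDisc.coe_injective h2)

/-- The functions `e_0^l` are the constant unit vectors. -/
lemma e_zero_apply (l : Fin (m + 1)) (z : Complex.UnitDisc) :
    e p l 0 z = EuclideanSpace.single l (1 : ℂ) := by
  ext i
  rw [e_apply, PiLp.smul_apply, Gam_monomial_apply]
  rcases lt_trichotomy i l with h | rfl | h
  · simp [gamCoef_of_lt p (show (i : ℕ) < l from h), h.ne]
  · simp [gamCoef_self, coef, poch]
  · have h' : (l : ℕ) < i := h
    simp [Nat.descFactorial_of_lt (show 0 < (i : ℕ) - l by omega), h.ne']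

/-- The components of `e_n^j` are monomials and the `e_0^l` are the constant unit vectors, so the
constants generate the space under `M`. Where the exponent is truncated, the falling factorial is
zero. -/
lemma e_eq_sum_pow_mulOperator
    (hM : ∀ (F : VecSpace p) (z : Complex.UnitDisc), M F z = (z : ℂ) • F z)
    (j : Fin (m + 1)) (n : ℕ) :
    e p j n = ∑ l : Fin (m + 1),
      ((coef (p.lamj j) n * gamCoef p j l * n.descFactorial (l - j) : ℝ) : ℂ) •
        (M ^ (n - (l - j) : ℕ)) (e p l 0) := by
  refine RKHS.ext fun z => ?_
  rw [sum_apply_unitDisc]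
  ext i
  simp only [WithLp.ofLp_sum, Finset.sum_apply, RKHS.coe_smul, Pi.smul_apply,
    pow_mulOperator_apply hM, e_zero_apply, PiLp.smul_apply, smul_eq_mul]
  rw [Finset.sum_eq_single i (fun l _ hl => by simp [hl.symm]) (by simp), e_apply,
    PiLp.smul_apply, Gam_monomial_apply]
  simp
  ring

lemma adjoint_mulOperator_kerFun
    (hM : ∀ (F : VecSpace p) (z : Complex.UnitDisc), M F z = (z : ℂ) • F z)
    (a : Complex.UnitDisc) (c : EuclideanSpace ℂ (Fin (m + 1))) :
    ContinuousLinearMap.adjoint M (RKHS.kerFun (VecSpace p) a c) =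
      conj (a : ℂ) • RKHS.kerFun (VecSpace p) a c := by
  refine ext_inner_right ℂ fun F => ?_
  rw [ContinuousLinearMap.adjoint_inner_left, RKHS.kerFun_inner, hM, inner_smul_right,
    inner_smul_left, RKHS.kerFun_inner, RCLike.conj_conj]

/-- Pairing with the constants recovers `c`, so the kernel functions at `a` form a space of full
dimension `m + 1`. -/
lemma inner_e_zero_kerFun (l : Fin (m + 1)) (a : Complex.UnitDisc)
    (c : EuclideanSpace ℂ (Fin (m + 1))) :
    inner ℂ (e p l 0) (RKHS.kerFun (VecSpace p) a c) = c l := by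
  rw [RKHS.inner_kerFun, e_zero_apply, EuclideanSpace.inner_single_left]
  simp

lemma kerFun_vecSpace_injective (a : Complex.UnitDisc) :
    Function.Injective (RKHS.kerFun (VecSpace p) a) := by
  intro c d h
  ext l
  rw [← inner_e_zero_kerFun l a c, h, inner_e_zero_kerFun]

/-- An eigenvector of the adjoint that is orthogonal to the constant functions vanishes. -/
lemma eq_zero_of_adjoint_eq_smul
    (hM : ∀ (F : VecSpace p) (z : Complex.UnitDisc), M F z = (z : ℂ) • F z) {w : ℂ}
    {v : VecSpace p} (hv : ContinuousLinearMap.adjoint M v = w • v)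
    (h0 : ∀ l, inner ℂ (e p l 0) v = 0) : v = 0 := by
  -- Each factor `M`, moved to the other side, acts on `v` as the scalar `w`.
  have hpow : ∀ (i : ℕ) (l : Fin (m + 1)), inner ℂ ((M ^ i) (e p l 0)) v = 0 := by
    intro i l
    induction i with
    | zero => simpa using h0 l
    | succ i ih =>
      rw [pow_succ', mul_apply_eq_comp, ← ContinuousLinearMap.adjoint_inner_right, hv,
        inner_smul_right, ih, mul_zero]
  have hb : ∀ a, (basis p).repr v a = 0 := by
    rintro ⟨j, n⟩
    rw [HilbertBasis.repr_apply_apply, basis_apply, e_eq_sum_pow_mulOperator hM, inner_smul_left,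
      sum_inner, Finset.sum_eq_zero, mul_zero]
    intro l _
    rw [inner_smul_left, hpow, mul_zero]
  exact (basis p).repr.map_eq_zero_iff.1 (lp.ext (funext hb))

/-- The eigenspaces of the adjoint consist of the kernel functions. -/
lemma ker_adjoint_sub_eq_range_kerFun
    (hM : ∀ (F : VecSpace p) (z : Complex.UnitDisc), M F z = (z : ℂ) • F z)
    (a : Complex.UnitDisc) :
    (ContinuousLinearMap.adjoint M - conj (a : ℂ) • ContinuousLinearMap.id ℂ (VecSpace p)).ker =
      (RKHS.kerFun (VecSpace p) a).range := by
  have hmem : ∀ v, v ∈ (ContinuousLinearMap.adjoint M -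
      conj (a : ℂ) • ContinuousLinearMap.id ℂ (VecSpace p)).ker ↔
        ContinuousLinearMap.adjoint M v = conj (a : ℂ) • v := fun v => by
    rw [LinearMap.mem_ker]
    exact sub_eq_zero
  ext v
  rw [hmem]
  constructor
  · intro hv
    -- The kernel function with the same pairings with the constants as `v`; the difference is an
    -- eigenvector orthogonal to the constants.
    refine ⟨WithLp.toLp 2 fun l => inner ℂ (e p l 0) v, ?_⟩
    refine (sub_eq_zero.1 (eq_zero_of_adjoint_eq_smul hM (w := conj (a : ℂ)) ?_ fun l => ?_)).symm
    · rw [map_sub, hv, smul_sub]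
      congr 1
      exact adjoint_mulOperator_kerFun hM a _
    · rw [inner_sub_right, sub_eq_zero]
      exact (inner_e_zero_kerFun l a (WithLp.toLp 2 fun l => inner ℂ (e p l 0) v)).symm
  · rintro ⟨c, rfl⟩
    exact adjoint_mulOperator_kerFun hM a c

/-- Multiplication by the coordinate function is the adjoint of a Cowen-Douglas operator when it is
a compact perturbation of an isometry. -/
lemma isCowenDouglas_adjoint
    (hM : ∀ (F : VecSpace p) (z : Complex.UnitDisc), M F z = (z : ℂ) • F z)
    {U : VecSpace p →ₗᵢ[ℂ] VecSpace p} {K : VecSpace p →L[ℂ] VecSpace p}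
    (hK : IsCompactOperator K) (hUK : M = U.toContinuousLinearMap + K) :
    IsCowenDouglas (ContinuousLinearMap.adjoint M) (Metric.ball 0 1) (m + 1) := by
  have hdisc : ∀ w ∈ Metric.ball (0 : ℂ) 1, ∃ a : Complex.UnitDisc, conj (a : ℂ) = w := by
    intro w hw
    have hw' : ‖conj w‖ < 1 := by simpa using hw
    exact ⟨.mk _ hw', by rw [Complex.UnitDisc.coe_mk, Complex.conj_conj]⟩
  have hfinrank : ∀ w ∈ Metric.ball (0 : ℂ) 1, Module.finrank ℂ (ContinuousLinearMap.adjoint M -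
      w • ContinuousLinearMap.id ℂ (VecSpace p)).ker = m + 1 := by
    intro w hw
    obtain ⟨a, rfl⟩ := hdisc w hw
    rw [ker_adjoint_sub_eq_range_kerFun hM a]
    refine (LinearMap.finrank_range_of_inj (kerFun_vecSpace_injective a)).trans ?_
    simp
  refine ⟨fun w hw hres => ?_, fun w hw => ?_, ?_, fun w hw => ?_, hfinrank⟩
  -- Were `w` in the resolvent set, the kernel would be zero, against its dimension `m + 1`.
  · have hu : IsUnit (algebraMap ℂ (VecSpace p →L[ℂ] VecSpace p) w -
      ContinuousLinearMap.adjoint M) := hres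
    have hker : (ContinuousLinearMap.adjoint M -
        w • ContinuousLinearMap.id ℂ (VecSpace p)).ker = ⊥ := by
      rw [Submodule.eq_bot_iff]
      intro v hv
      obtain ⟨u, hu⟩ := hu
      have h1 : (u : VecSpace p →L[ℂ] VecSpace p) v = 0 := by
        rw [hu, ← neg_sub, neg_apply, neg_eq_zero]
        exact hv
      have h2 : (↑u⁻¹ * ↑u : VecSpace p →L[ℂ] VecSpace p) v = v := by simp
      rw [← h2, mul_apply_eq_comp, h1, map_zero]
    have := hfinrank w hw
    rw [hker, finrank_bot] at this
    omega
  · obtain ⟨a, rfl⟩ := hdisc w hw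
    -- `U` is isometric, so `U - a` is bounded below by `1 - |a| > 0`; injectivity of `M - a` then
    -- lets the compact `K` be added.
    have hA : ∀ x, (1 - ‖(a : ℂ)‖) * ‖x‖ ≤ ‖(U.toContinuousLinearMap -
        (a : ℂ) • ContinuousLinearMap.id ℂ (VecSpace p)) x‖ := fun x => by
      have h := norm_sub_norm_le (U x) ((a : ℂ) • x)
      rw [U.norm_map, norm_smul] at h
      calc (1 - ‖(a : ℂ)‖) * ‖x‖ = ‖x‖ - ‖(a : ℂ)‖ * ‖x‖ := by ring
        _ ≤ _ := h
    have hsplit : ∀ x, (U.toContinuousLinearMap -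
        (a : ℂ) • ContinuousLinearMap.id ℂ (VecSpace p)) x + K x =
          (M - (a : ℂ) • ContinuousLinearMap.id ℂ (VecSpace p)) x := fun x => by
      rw [hUK]
      simp only [sub_apply, add_apply]
      abel
    obtain ⟨c, hc, hle⟩ := exists_norm_le_of_isCompactOperator (sub_pos.2 a.norm_lt_one) hA hK
      fun x hx => by
        rw [hsplit] at hx
        exact mulOperator_sub_injective hM a (sub_eq_zero.1 hx)
    simp only [hsplit] at hle
    have hadj : ContinuousLinearMap.adjoint
        (M - (a : ℂ) • ContinuousLinearMap.id ℂ (VecSpace p)) =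
          ContinuousLinearMap.adjoint M - conj (a : ℂ) • ContinuousLinearMap.id ℂ (VecSpace p) := by
      rw [map_sub, map_smulₛₗ, ContinuousLinearMap.adjoint_id]
    rw [← hadj]
    exact surjective_adjoint_of_norm_le hc hle
  · rw [eq_top_iff, ← RKHS.kerFun_dense (H := VecSpace p)]
    refine Submodule.topologicalClosure_mono (Submodule.span_le.2 ?_)
    rintro _ ⟨a, c, rfl⟩
    refine Submodule.mem_iSup_of_mem (conj (a : ℂ)) (Submodule.mem_iSup_of_mem ?_ ?_)
    · simpa using a.norm_lt_one
    · rw [ker_adjoint_sub_eq_range_kerFun hM a]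
      exact ⟨c, rfl⟩
  · exact FiniteDimensional.of_finrank_pos (by rw [hfinrank w hw]; exact Nat.succ_pos m)

end CowenDouglas

end HomogShift

end

/-! ### Assembly of the theorem. -/

theorem mainTheorem3 (m : ℕ) (hm : 0 < m) (p : HomogShift.Params m) :
    ∃ M U : HomogShift.VecSpace p →L[ℂ] HomogShift.VecSpace p,
      -- `M` is the operator of multiplication by the coordinate function
      (∀ (F : HomogShift.VecSpace p) (z : Complex.UnitDisc), M F z = (z : ℂ) • F z) ∧
      -- `U` is the block unilateral shift
      (∀ (j : Fin (m + 1)) (n : ℕ), U (HomogShift.e p j n) = HomogShift.e p j (n + 1)) ∧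
      HomogShift.IsBlockShift M (HomogShift.blockSpace p) ∧
      -- the blocks `B n` of `M` with respect to the orthonormal vectors `μ_j e_{n-j}^j`
      (∃ B : ℕ → Matrix (Fin (m + 1)) (Fin (m + 1)) ℂ,
        (∀ (n : ℕ) (j : Fin (m + 1)), (j : ℕ) ≤ n →
          M ((p.mu j : ℂ) • HomogShift.e p j (n - j)) =
            ∑ k ∈ Finset.univ.filter (fun k : Fin (m + 1) => (k : ℕ) ≤ n + 1),
              B n k j • (p.mu k : ℂ) • HomogShift.e p k (n + 1 - k)) ∧
        ∀ k j : Fin (m + 1),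
          (fun n : ℕ => B n k j - (1 : Matrix (Fin (m + 1)) (Fin (m + 1)) ℂ) k j)
            =O[Filter.atTop] fun n : ℕ => 1 / (n : ℝ)) ∧
      HomogShift.IsHilbertSchmidt (M - U) ∧
      HomogShift.IsCowenDouglas (ContinuousLinearMap.adjoint M) (Metric.ball 0 1) (m + 1) := by
  obtain ⟨U, K, hU, hUK, hKs, hKc⟩ := HomogShift.exists_mulOperator p
  have hM : ∀ (F : HomogShift.VecSpace p) (z : Complex.UnitDisc),
      (U.toContinuousLinearMap + K) F z = (z : ℂ) • F z := by
    intro F z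
    -- Evaluation at `z` is continuous, so it is enough to compare both sides on the basis.
    have h : HomogShift.evalCLM p z ∘L (U.toContinuousLinearMap + K) =
        (z : ℂ) • HomogShift.evalCLM p z := by
      refine HomogShift.clm_ext_hilbertBasis (b := HomogShift.basis p) ?_
      rintro ⟨j, n⟩
      change (U (HomogShift.basis p (j, n)) + K (HomogShift.basis p (j, n))) z =
        (z : ℂ) • HomogShift.basis p (j, n) z
      rw [hUK, HomogShift.smul_basis_apply]
    exact congrArg (fun T => T F) h
  have hblock : ∀ (n : ℕ) (j : Fin (m + 1)), (j : ℕ) ≤ n →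
      (U.toContinuousLinearMap + K) ((p.mu j : ℂ) • HomogShift.e p j (n - j)) =
        ∑ k ∈ Finset.univ.filter (fun k : Fin (m + 1) => (k : ℕ) ≤ n + 1),
          (HomogShift.entry p k j (n - j) : ℂ) • (p.mu k : ℂ) •
            HomogShift.e p k (n + 1 - k) := by
    intro n j hj
    rw [← HomogShift.basis_apply]
    refine (hUK j (n - j)).trans ?_
    rw [Finset.sum_filter]
    refine Finset.sum_congr rfl fun k _ => ?_
    split_ifs with hk
    · rw [HomogShift.basis_apply, show n - (j : ℕ) + 1 + j = n + 1 by omega]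
    · rw [HomogShift.entry_eq_zero p (by omega), Complex.ofReal_zero, zero_smul]
  refine ⟨U.toContinuousLinearMap + K, U.toContinuousLinearMap, hM, fun j n => ?_,
    ⟨HomogShift.isHilbertSum_blockSpace p, fun n v hv => ?_⟩,
    -- For `j > n` the truncated `n - j = 0` gives column `j` an arbitrary value; this concerns only
    -- finitely many `n`.
    ⟨fun n => Matrix.of fun k j => (HomogShift.entry p k j (n - j) : ℂ), hblock, fun k j => ?_⟩,
    by rwa [add_sub_cancel_left], HomogShift.isCowenDouglas_adjoint hM hKc rfl⟩
  · rw [HomogShift.e_eq_smul_basis, HomogShift.e_eq_smul_basis, map_smul]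
    exact congrArg _ (hU j n)
  · induction hv using Submodule.span_induction with
    | mem v hv =>
      obtain ⟨j, hj, rfl⟩ := hv
      have h := hblock n j hj
      rw [map_smul, ← eq_inv_smul_iff₀ (HomogShift.mu_ne_zero p j)] at h
      rw [h]
      refine Submodule.smul_mem _ _ (Submodule.sum_mem _ fun k hk => ?_)
      have hk' : (k : ℕ) ≤ n + 1 := (Finset.mem_filter.1 hk).2
      exact Submodule.smul_mem _ _ (Submodule.smul_mem _ _
        (HomogShift.e_mem_blockSpace p (by omega)))
    | zero => rw [map_zero]; exact Submodule.zero_mem _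
    | add v w _ _ hv hw => rw [map_add]; exact Submodule.add_mem _ hv hw
    | smul c v _ hv => rw [map_smul]; exact Submodule.smul_mem _ c hv
  · obtain ⟨C, hC0, hC⟩ := HomogShift.exists_abs_entry_sub_le p k j
    -- The factor `j + 1` absorbs the shift from `n - j` to `n`: `n ≤ (j + 1)(n - j + 1)`, also
    -- under truncation.
    refine Asymptotics.IsBigO.of_bound (C * (j + 1)) ?_
    filter_upwards [Filter.eventually_gt_atTop 0] with n hn
    have h := hC (n - j)
    have hn' : (0 : ℝ) < n := by exact_mod_cast hn
    have h1 : ((HomogShift.entry p k j (n - j) : ℂ)) -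
        (1 : Matrix (Fin (m + 1)) (Fin (m + 1)) ℂ) k j =
          ((HomogShift.entry p k j (n - j) - if k = j then 1 else 0 : ℝ) : ℂ) := by
      rw [Matrix.one_apply]
      split_ifs <;> simp
    rw [Matrix.of_apply, h1, Complex.norm_real, Real.norm_eq_abs, Real.norm_eq_abs,
      abs_of_nonneg (one_div_nonneg.2 hn'.le), mul_one_div]
    refine h.trans ?_
    rw [div_le_div_iff₀ (by positivity) hn', mul_assoc]
    refine mul_le_mul_of_nonneg_left ?_ hC0
    have : n ≤ (j + 1) * (n - j + 1) := by
      have : n ≤ n - j + j := by omega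
      nlinarith [Nat.zero_le ((j : ℕ) * (n - j))]
    exact_mod_cast this
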